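/- Let $\mathbb{F}_q$ be a finite field with $q$ elements, $K=\mathbb{F}_q(\theta)$, and let $K_\infty$ be the completion of $K$ at the infinite place. Put $l_0=1$, $l_i=(\theta-\theta^{q^i})l_{i-1}$ and $D_0=1$, $D_i=(\theta^{q^i}-\theta)D_{i-1}^q$ for $i\ge 1$. An array is a finite tuple $\mathfrak{n}=(n_1,\ldots,n_r)$ of positive integers, of depth $r\ge 0$ and weight $\sum_i n_i$. For $i\ge 0$ put $L_{<i}(\emptyset)=1$ and, if $r\geq 1$, $L_i(\mathfrak{n})=l_i^{-n_1}L_{<i}(n_2,\ldots,n_r)$ and $L_{<i}(\mathfrak{n})=\sum_{j<i}L_j(\mathfrak{n})$. Put $\mathcal{L}(\mathfrak{n})=\lim_{i\to\infty}L_{<i}(\mathfrak{n})\in K_\infty$ (a multiple polylogarithm at one). Extend $L_i$ and $\mathcal{L}$ $K$-linearly to the $K$-vector space $\mathfrak{H}$ with basis the arrays. Let $*$ be the stuffle product, that is, the bilinear product on $\mathfrak{H}$ with unit $\emptyset$ such that, for positive integers $a,b$ and arrays $\mathfrak{m},\mathfrak{n}$, $(a,\mathfrak{m})*(b,\mathfrak{n})=(a,\mathfrak{m}*(b,\mathfrak{n}))+(b,(a,\mathfrak{m})*\mathfrak{n})+(a+b,\mathfrak{m}*\mathfrak{n})$,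 and let $\triangleright$ be the bilinear triangle product with $(a,\mathfrak{m})\triangleright\mathfrak{n}=(a,\mathfrak{m}*\mathfrak{n})$ and $\emptyset\triangleright\mathfrak{n}=\mathfrak{n}$. Iterated triangle products are bracketed to the right: $\mathfrak{a}\triangleright\mathfrak{b}\triangleright\mathfrak{c}=\mathfrak{a}\triangleright(\mathfrak{b}\triangleright\mathfrak{c})$. Fix $d\ge 1$. For $s\ge 0$ let $f_s(x,y,z)=\frac{(z-y)^s-(x-y)^s}{z-x}$, a polynomial. For $0\le h<d$ and $j\ge 1$ put $$\alpha_{h,j}=\binom{d}{h}(\theta-\theta^q)^hf_{d-h}(\theta,\theta^q,\theta^{q^j})\in K,\qquad \mathfrak{c}_h=\big((d-h)(q-1),\,(q-1)^{*h}\big)\in\mathfrak{H}.$$ For $m\ge 1$ and $\underline{h}=(h_1,\ldots,h_m)\in\{0,\ldots,d-1\}^m$ put $$\alpha_{\underline{h}}=\prod_{j=1}^m\alpha_{h_j,m-j+1}^{q^{j-1}},\qquad \mathfrak{k}_{\underline{h}}=(d)\triangleright\mathfrak{c}_{h_1}\triangleright\mathfrak{c}_{h_2}^{*q}\triangleright\cdots\triangleright\mathfrak{c}_{h_m}^{*q^{m-1}}.$$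 **Theorem D.** Let $d,m\ge 1$. 1. For all $k\ge m$, $$L_{k-m}(dq^m)=l_{k-m}^{-dq^m}=(-1)^mD_m\sum_{\underline{h}\in\{0,\ldots,d-1\}^m}\alpha_{\underline{h}}\,L_k(\mathfrak{k}_{\underline{h}}).$$ 2. Every array that occurs with a non-zero coefficient in some $\mathfrak{k}_{\underline{h}}$ has weight $dq^m$ and depth at least two, and is of the form $(d,x_1(q-1),\ldots,x_r(q-1))$ for an array $(x_1,\ldots,x_r)$ of weight $d\frac{q^m-1}{q-1}$. 3. For every array $\mathfrak{n}$ the limit that defines $\mathcal{L}(\mathfrak{n})$ exists in $K_\infty$, and $$\mathcal{L}(d)^{q^m}=\mathcal{L}(dq^m)=(-1)^mD_m\sum_{\underline{h}\in\{0,\ldots,d-1\}^m}\alpha_{\underline{h}}\,\mathcal{L}(\mathfrak{k}_{\underline{h}}),$$ an expansion of $\mathcal{L}(d)^{q^m}$ as a $K$-linear combination of multiple polylogarithms at one of weight $dq^m$. It is non-trivial: in $\mathfrak{H}$, the array $(dq^m)$ is different from $(-1)^mD_m\sum_{\underline{h}}\alpha_{\underline{h}}\mathfrak{k}_{\underline{h}}$.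 -/

import Mathlib

open Filter Topology Finset

namespace CarlitzPolylog

/-- An array: a finite tuple of positive integers. The empty list is the array of depth zero, and
the length of the list is the depth. -/
abbrev Arr : Type := List ℕ+

/-- The weight of an array: the sum of its entries. -/
def weight (n : Arr) : ℕ := (n.map (fun a : ℕ+ => (a : ℕ))).sum

/-- The space of formal finite `R`-linear combinations of arrays. -/
abbrev Comb (R : Type*) [CommRing R] : Type _ := Arr →₀ R

section Products

variable (R : Type*) [CommRing R]

/-- An array as a basis element. -/
noncomputable def arr (n : Arr) : Comb R := Finsupp.single n 1

/-- Concatenation on the left with the array `(a)` of depth one, extended linearly. -/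
noncomputable def prepend (a : ℕ+) : Comb R →ₗ[R] Comb R :=
  Finsupp.lmapDomain R R (List.cons a)

/-- The stuffle product of two arrays. -/
noncomputable def stuffleArr : Arr → Arr → Comb R
  | [], n => arr R n
  | a :: m, [] => arr R (a :: m)
  | a :: m, b :: n =>
      prepend R a (stuffleArr m (b :: n)) + prepend R b (stuffleArr (a :: m) n)
        + prepend R (a + b) (stuffleArr m n)
  termination_by m n => m.length + n.length

/-- The stuffle product `*`, extended bilinearly. -/
noncomputable def stuffle : Comb R →ₗ[R] Comb R →ₗ[R] Comb R :=
  Finsupp.linearCombination R fun m : Arr =>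
    Finsupp.linearCombination R fun n : Arr => stuffleArr R m n

/-- The powers for the stuffle product; the zeroth power is the empty array. -/
noncomputable def stufflePow (x : Comb R) : ℕ → Comb R
  | 0 => arr R []
  | e + 1 => stuffle R x (stufflePow x e)

/-- The triangle product of two arrays: the first entry of the first array, followed by the stuffle
product of its remaining part and the second array. The empty array acts as a unit. -/
noncomputable def triangleArr : Arr → Arr → Comb R
  | [], n => arr R n
  | a :: m, n => prepend R a (stuffleArr R m n)

/-- The triangle product, extended bilinearly. -/
noncomputable def triangle : Comb R →ₗ[R] Comb R →ₗ[R] Comb R :=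
  Finsupp.linearCombination R fun m : Arr =>
    Finsupp.linearCombination R fun n : Arr => triangleArr R m n

/-- The iterated triangle product `x₁ ▷ (x₂ ▷ (⋯ ▷ xᵣ))`. -/
noncomputable def triangleChain (l : List (Comb R)) : Comb R :=
  l.foldr (fun x y => triangle R x y) (arr R [])

/-- The polynomial `((z - y) ^ d - (x - y) ^ d) / (z - x)`. -/
def fPoly {R : Type*} [CommRing R] (d : ℕ) (x y z : R) : R :=
  ∑ j ∈ range d, (z - y) ^ j * (x - y) ^ (d - 1 - j)

end Products

section Carlitz

variable (F : Type*) [Field F] [Fintype F]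

/-- `q`, the number of elements of the finite field, as a positive integer. -/
def qq : ℕ+ := ⟨Fintype.card F, Fintype.card_pos⟩

/-- `q - 1` as a positive integer. -/
def qSubOne : ℕ+ := ⟨Fintype.card F - 1, Nat.sub_pos_of_lt Fintype.one_lt_card⟩

/-- The indeterminate `θ` of `K = F(θ)`. -/
noncomputable def θ : RatFunc F := RatFunc.X

/-- `l₀ = 1`, `lᵢ = (θ - θ ^ (q ^ i)) lᵢ₋₁`. -/
noncomputable def l : ℕ → RatFunc F
  | 0 => 1
  | i + 1 => (θ F - θ F ^ (Fintype.card F ^ (i + 1))) * l i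

/-- `D₀ = 1`, `Dₖ = (θ ^ (q ^ k) - θ) Dₖ₋₁ ^ q`. -/
noncomputable def D : ℕ → RatFunc F
  | 0 => 1
  | k + 1 => (θ F ^ (Fintype.card F ^ (k + 1)) - θ F) * D k ^ Fintype.card F

/-- The multiple sum `L_{<i}(n)`; its value at the empty array is `1`. -/
noncomputable def LltArr : Arr → ℕ → RatFunc F
  | [], _ => 1
  | a :: n, i => ∑ j ∈ range i, (l F j ^ (a : ℕ))⁻¹ * LltArr n j

/-- `Lᵢ(n) = lᵢ ^ (-n₁) L_{<i}(n₂, …, nᵣ)`; its value at the empty array is `1`. -/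
noncomputable def LArr : Arr → ℕ → RatFunc F
  | [], _ => 1
  | a :: n, i => (l F i ^ (a : ℕ))⁻¹ * LltArr F n i

/-- `Lᵢ`, extended linearly. -/
noncomputable def L (i : ℕ) : Comb (RatFunc F) →ₗ[RatFunc F] RatFunc F :=
  Finsupp.linearCombination (RatFunc F) fun n : Arr => LArr F n i

/-- The coefficients `α_{h,j}` (for the fixed integer `d`). -/
noncomputable def α (d : ℕ+) (h j : ℕ) : RatFunc F :=
  (Nat.choose d h : RatFunc F) * (θ F - θ F ^ Fintype.card F) ^ h
    * fPoly ((d : ℕ) - h) (θ F) (θ F ^ Fintype.card F) (θ F ^ (Fintype.card F ^ j))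

/-- The element `𝔠_h`: the entry `(d - h)(q - 1)` followed by the `h`-th stuffle power of the array
`(q - 1)`. -/
noncomputable def c (d : ℕ+) (h : Fin d) : Comb (RatFunc F) :=
  prepend (RatFunc F) (⟨(d : ℕ) - h, Nat.sub_pos_of_lt h.isLt⟩ * qSubOne F)
    (stufflePow (RatFunc F) (arr (RatFunc F) [qSubOne F]) h)

/-- The product `α_{h₁,m} α_{h₂,m-1}^q ⋯ α_{hₘ,1}^{q^{m-1}}`; the entry `h_{j+1}` is `h j`. -/
noncomputable def coef (d : ℕ+) (m : ℕ) (h : Fin m → Fin d) : RatFunc F :=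
  ∏ j : Fin m, α F d (h j) (m - j) ^ (Fintype.card F ^ (j : ℕ))

/-- The element `(d) ▷ (𝔠_{h₁} ▷ (𝔠_{h₂}^{*q} ▷ (⋯ ▷ 𝔠_{hₘ}^{*q^{m-1}})))`. -/
noncomputable def kElt (d : ℕ+) (m : ℕ) (h : Fin m → Fin d) : Comb (RatFunc F) :=
  triangleChain (RatFunc F)
    (arr (RatFunc F) [d] ::
      List.ofFn fun j : Fin m => stufflePow (RatFunc F) (c F d (h j)) (Fintype.card F ^ (j : ℕ)))

variable [DecidableEq (RatFunc F)]

/-- The multiple polylogarithm at one of an array: the limit of `L_{<i}(n)` in the completion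
of `K` at the infinite place. -/
noncomputable def LiArr (n : Arr) : RatFunc.CompletionAtInfty F :=
  limUnder atTop fun i : ℕ =>
    algebraMap (RatFunc F) (RatFunc.CompletionAtInfty F) (LltArr F n i)

/-- The multiple polylogarithm at one, extended linearly. -/
noncomputable def Li : Comb (RatFunc F) →ₗ[RatFunc F] RatFunc.CompletionAtInfty F :=
  Finsupp.linearCombination (RatFunc F) fun n : Arr => LiArr F n

end Carlitz

end CarlitzPolylog

namespace CarlitzPolylog

/-! ### Combinations of arrays and the supports of their products -/

section Products

variable {R : Type*} [CommRing R]

/-! `L_{<k}` turns stuffle products into products, and `L_k(x ▷ y) = L_k(x) L_{<k}(y)`. Frobenius is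
additive, so `L_k(𝔠_h^{*q^s}) = L_k(𝔠_h)^{q^s}`. The weighted sum `S_m(k)` of the `L_{<k}` of the
chains without the leading `(d)` therefore satisfies `S_{m+1}(k) = ∑_{j<k} A_{m+1}(j) S_m(j)^q`,
where `A_i(j) = ∑_h α_{h,i} L_j(𝔠_h)` (`chainSum_succ`).

The closed form of `L_{<k}(q-1)` and the binomial theorem make `(θ - θ^{q^i}) A_i(j)` a difference
of two `d`-th powers (`sum_α_mul_L_c`). With it the sum over `j` telescopes: `(-1)^m D_m S_m(k)`
equals `l_k^d / l_{k-m}^{d q^m}` for `m ≤ k` and `0` for `k < m` (`chainSum_eq`). Prepending `(d)`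
divides by `l_k^d`, which gives the finite identity. Summing over `k` and passing to the limit gives
the identity of polylogarithms.

The shape of the arrays follows because stuffle and triangle products add weights and preserve
divisibility of the entries by `q - 1`. -/

theorem prepend_arr (a : ℕ+) (n : Arr) : prepend R a (arr R n) = arr R (a :: n) := by
  simp [prepend, arr, Finsupp.mapDomain_single]

theorem stuffle_arr_arr (m n : Arr) :
    stuffle R (arr R m) (arr R n) = stuffleArr R m n := by
  simp [stuffle, arr]

theorem triangle_arr_arr (m n : Arr) :
    triangle R (arr R m) (arr R n) = triangleArr R m n := by
  simp [triangle, arr]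

theorem comb_eq_sum (x : Comb R) : x = ∑ n ∈ x.support, x n • arr R n := by
  conv_lhs => rw [← Finsupp.sum_single x]
  simp [Finsupp.sum, arr]

theorem linearMap_ext_arr {M : Type*} [AddCommGroup M] [Module R M] {f g : Comb R →ₗ[R] M}
    (h : ∀ n, f (arr R n) = g (arr R n)) : f = g :=
  Finsupp.lhom_ext' fun n => LinearMap.ext_ring (h n)

theorem triangle_arr_singleton (a : ℕ+) : triangle R (arr R [a]) = prepend R a := by
  refine linearMap_ext_arr fun n => ?_
  rw [triangle_arr_arr, triangleArr, stuffleArr]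

theorem arr_mem_supported {s : Set Arr} {n : Arr} (hn : n ∈ s) :
    arr R n ∈ Finsupp.supported R R s :=
  Finsupp.single_mem_supported R 1 hn

/-- A linear map that sends the arrays of a set into a submodule sends all combinations of these
arrays into it. -/
theorem map_mem_of_mem_supported {M : Type*} [AddCommGroup M] [Module R M] (f : Comb R →ₗ[R] M)
    {s : Set Arr} {N : Submodule R M} (h : ∀ n ∈ s, f (arr R n) ∈ N) {x : Comb R}
    (hx : x ∈ Finsupp.supported R R s) : f x ∈ N := by
  rw [comb_eq_sum x, map_sum]
  refine N.sum_mem fun n hn => ?_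
  rw [map_smul]
  exact N.smul_mem _ (h n (hx hn))

theorem map₂_mem_of_mem_supported {M : Type*} [AddCommGroup M] [Module R M]
    (f : Comb R →ₗ[R] Comb R →ₗ[R] M) {s t : Set Arr} {N : Submodule R M}
    (h : ∀ m ∈ s, ∀ n ∈ t, f (arr R m) (arr R n) ∈ N) {x y : Comb R}
    (hx : x ∈ Finsupp.supported R R s) (hy : y ∈ Finsupp.supported R R t) : f x y ∈ N :=
  map_mem_of_mem_supported (f.flip y)
    (fun m hm => map_mem_of_mem_supported (f (arr R m)) (h m hm) hy) hx

/-- The arrays `(x₁ e, …, xᵣ e)` with `x` of weight `w`. -/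
def scaledArrays (e : ℕ+) (w : ℕ) : Set Arr :=
  {n | ∃ x : Arr, n = x.map (fun a => a * e) ∧ weight x = w}

theorem weight_cons (a : ℕ+) (n : Arr) : weight (a :: n) = a + weight n := by
  simp [weight]

theorem weight_map_mul (e : ℕ+) (x : Arr) : weight (x.map fun a => a * e) = weight x * e := by
  induction x with
  | nil => simp [weight]
  | cons a x ih => simp only [List.map_cons, weight_cons, ih, PNat.mul_coe]; ring

theorem cons_mem_scaledArrays {e : ℕ+} {w : ℕ} {n : Arr} (a : ℕ+) (hn : n ∈ scaledArrays e w) :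
    (a * e) :: n ∈ scaledArrays e (a + w) := by
  obtain ⟨x, rfl, rfl⟩ := hn
  exact ⟨a :: x, rfl, weight_cons a x⟩

theorem prepend_mem_scaled {e : ℕ+} {w w' : ℕ} (a : ℕ+) (hw : a + w = w') {x : Comb R}
    (hx : x ∈ Finsupp.supported R R (scaledArrays e w)) :
    prepend R (a * e) x ∈ Finsupp.supported R R (scaledArrays e w') := by
  refine map_mem_of_mem_supported _ (fun n hn => ?_) hx
  rw [prepend_arr]
  exact arr_mem_supported (hw ▸ cons_mem_scaledArrays a hn)

theorem stuffleArr_map_mem_scaled (e : ℕ+) (x y : Arr) :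
    stuffleArr R (x.map fun a => a * e) (y.map fun a => a * e) ∈
      Finsupp.supported R R (scaledArrays e (weight x + weight y)) := by
  induction x generalizing y with
  | nil =>
    rw [List.map_nil, stuffleArr]
    exact arr_mem_supported ⟨y, rfl, by simp [weight]⟩
  | cons a x ihx =>
    induction y with
    | nil =>
      rw [List.map_nil, List.map_cons, stuffleArr]
      exact arr_mem_supported ⟨a :: x, rfl, by simp [weight]⟩
    | cons b y ihy =>
      have h1 := ihx (b :: y)
      have h2 := ihx y
      rw [List.map_cons] at h1 ihy
      rw [List.map_cons, List.map_cons, stuffleArr]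
      refine Submodule.add_mem _ (Submodule.add_mem _ ?_ ?_) ?_
      · exact prepend_mem_scaled a (by simp only [weight_cons]; ring) h1
      · exact prepend_mem_scaled b (by simp only [weight_cons]; ring) ihy
      · rw [← add_mul]
        exact prepend_mem_scaled (a + b) (by simp only [weight_cons, PNat.add_coe]; ring) h2

theorem stuffle_mem_scaled {e : ℕ+} {w₁ w₂ : ℕ} {x y : Comb R}
    (hx : x ∈ Finsupp.supported R R (scaledArrays e w₁))
    (hy : y ∈ Finsupp.supported R R (scaledArrays e w₂)) :
    stuffle R x y ∈ Finsupp.supported R R (scaledArrays e (w₁ + w₂)) := by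
  refine map₂_mem_of_mem_supported _ ?_ hx hy
  rintro _ ⟨x, rfl, rfl⟩ _ ⟨y, rfl, rfl⟩
  rw [stuffle_arr_arr]
  exact stuffleArr_map_mem_scaled e x y

theorem stufflePow_mem_scaled {e : ℕ+} {w : ℕ} {x : Comb R}
    (hx : x ∈ Finsupp.supported R R (scaledArrays e w)) (k : ℕ) :
    stufflePow R x k ∈ Finsupp.supported R R (scaledArrays e (k * w)) := by
  induction k with
  | zero => exact arr_mem_supported ⟨[], rfl, by simp [weight]⟩
  | succ k ih =>
    rw [stufflePow, add_mul, one_mul, add_comm]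
    exact stuffle_mem_scaled hx ih

theorem triangle_mem_scaled {e : ℕ+} {w₁ w₂ : ℕ} {x y : Comb R}
    (hx : x ∈ Finsupp.supported R R (scaledArrays e w₁))
    (hy : y ∈ Finsupp.supported R R (scaledArrays e w₂)) :
    triangle R x y ∈ Finsupp.supported R R (scaledArrays e (w₁ + w₂)) := by
  refine map₂_mem_of_mem_supported _ ?_ hx hy
  rintro _ ⟨x, rfl, rfl⟩ _ ⟨y, rfl, rfl⟩
  rw [triangle_arr_arr]
  cases x with
  | nil => exact arr_mem_supported ⟨y, rfl, by simp [weight]⟩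
  | cons a x =>
    rw [List.map_cons, triangleArr]
    exact prepend_mem_scaled a (by rw [weight_cons, add_assoc])
      (stuffleArr_map_mem_scaled e x y)

/-- A combination of scaled arrays of positive weight does not involve the empty array. -/
theorem apply_nil_of_mem_scaled {e : ℕ+} {w : ℕ} (hw : 0 < w) {x : Comb R}
    (hx : x ∈ Finsupp.supported R R (scaledArrays e w)) : x [] = 0 := by
  by_contra h
  obtain ⟨y, hy, rfl⟩ := hx (Finsupp.mem_support_iff.2 h)
  rw [List.nil_eq, List.map_eq_nil_iff] at hy
  simp [hy, weight] at hw

theorem exists_of_mem_support_prepend {a : ℕ+} {x : Comb R} {n : Arr}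
    (hn : n ∈ (prepend R a x).support) : ∃ n' ∈ x.support, n = a :: n' := by
  classical
  obtain ⟨n', h, rfl⟩ := Finset.mem_image.1 (Finsupp.mapDomain_support hn)
  exact ⟨n', h, rfl⟩

theorem fPoly_mul_sub (s : ℕ) (x y z : R) :
    fPoly s x y z * (z - x) = (z - y) ^ s - (x - y) ^ s := by
  have := Commute.geom_sum₂_mul (Commute.all (z - y) (x - y)) s
  rwa [sub_sub_sub_cancel_right] at this

end Products

/-! ### Multiple sums of stuffle and triangle products -/

section Carlitz

variable (F : Type*) [Field F] [Fintype F]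

/-- `L_{<i}`, extended linearly. -/
noncomputable def Llt (i : ℕ) : Comb (RatFunc F) →ₗ[RatFunc F] RatFunc F :=
  Finsupp.linearCombination (RatFunc F) fun n : Arr => LltArr F n i

@[simp]
theorem Llt_arr (i : ℕ) (n : Arr) : Llt F i (arr _ n) = LltArr F n i := by
  simp [Llt, arr]

@[simp]
theorem L_arr (i : ℕ) (n : Arr) : L F i (arr _ n) = LArr F n i := by
  simp [L, arr]

theorem Llt_prepend (i : ℕ) (a : ℕ+) (x : Comb (RatFunc F)) :
    Llt F i (prepend _ a x) = ∑ j ∈ range i, (l F j ^ (a : ℕ))⁻¹ * Llt F j x := by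
  have : Llt F i ∘ₗ prepend _ a = ∑ j ∈ range i, (l F j ^ (a : ℕ))⁻¹ • Llt F j := by
    refine linearMap_ext_arr fun n => ?_
    simp [prepend_arr, LltArr]
  simpa using DFunLike.congr_fun this x

theorem L_prepend (i : ℕ) (a : ℕ+) (x : Comb (RatFunc F)) :
    L F i (prepend _ a x) = (l F i ^ (a : ℕ))⁻¹ * Llt F i x := by
  have : L F i ∘ₗ prepend _ a = (l F i ^ (a : ℕ))⁻¹ • Llt F i := by
    refine linearMap_ext_arr fun n => ?_
    simp [prepend_arr, LArr]
  simpa using DFunLike.congr_fun this x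

theorem LltArr_cons_succ (a : ℕ+) (n : Arr) (i : ℕ) :
    LltArr F (a :: n) (i + 1) = LltArr F (a :: n) i + LArr F (a :: n) i := by
  rw [LltArr, sum_range_succ, ← LltArr, LArr]

/-- The empty array must be excluded: there `L_{<i}` and `L_i` are both `1`. -/
theorem Llt_succ {x : Comb (RatFunc F)} (hx : x [] = 0) (i : ℕ) :
    Llt F (i + 1) x = Llt F i x + L F i x := by
  have h : x ∈ Finsupp.supported (RatFunc F) (RatFunc F) {n : Arr | n ≠ []} := by
    rintro n hn rfl
    exact Finsupp.mem_support_iff.1 hn hx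
  have := map_mem_of_mem_supported (Llt F (i + 1) - (Llt F i + L F i)) (N := ⊥) ?_ h
  · simpa [sub_eq_zero] using this
  · rintro (_ | ⟨a, n⟩) hn
    · exact absurd rfl hn
    · simp [LltArr_cons_succ]

theorem Llt_eq_sum_L {x : Comb (RatFunc F)} (hx : x [] = 0) (i : ℕ) :
    Llt F i x = ∑ j ∈ range i, L F j x := by
  induction i with
  | zero =>
    rw [comb_eq_sum x, map_sum]
    refine sum_eq_zero fun n hn => ?_
    cases n with
    | nil => exact absurd hx (Finsupp.mem_support_iff.1 hn)
    | cons a n => simp [LltArr]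
  | succ i ih => rw [Llt_succ F hx, ih, sum_range_succ]

/-- In a product of two nested sums, the leading index of the first factor is larger than, smaller
than or equal to that of the second; these cases are the three terms of the stuffle recursion. -/
theorem Llt_stuffleArr (i : ℕ) (m n : Arr) :
    Llt F i (stuffleArr _ m n) = LltArr F m i * LltArr F n i := by
  induction m generalizing n i with
  | nil => simp [stuffleArr, LltArr]
  | cons a m ihm =>
    induction n generalizing i with
    | nil => simp [stuffleArr, LltArr]
    | cons b n ihn =>
      rw [stuffleArr]
      simp only [map_add, Llt_prepend, ihm, ihn, PNat.add_coe, pow_add, mul_inv]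
      induction i with
      | zero => simp [LltArr]
      | succ i ih =>
        simp only [sum_range_succ, LltArr_cons_succ, LArr]
        linear_combination ih

theorem Llt_stuffle (i : ℕ) (x y : Comb (RatFunc F)) :
    Llt F i (stuffle _ x y) = Llt F i x * Llt F i y := by
  have : (stuffle (RatFunc F)).compr₂ (Llt F i) =
      (LinearMap.mul (RatFunc F) (RatFunc F)).compl₁₂ (Llt F i) (Llt F i) := by
    refine linearMap_ext_arr fun m => linearMap_ext_arr fun n => ?_
    simp [stuffle_arr_arr, Llt_stuffleArr]
  simpa using LinearMap.congr_fun₂ this x y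

theorem Llt_stufflePow (i : ℕ) (x : Comb (RatFunc F)) (e : ℕ) :
    Llt F i (stufflePow _ x e) = Llt F i x ^ e := by
  induction e with
  | zero => simp [stufflePow, LltArr]
  | succ e ih => rw [stufflePow, Llt_stuffle, ih, pow_succ']

/-- The first entry of `x` pins the leading index to `i`; what follows is a stuffle product
evaluated by `L_{<i}`. -/
theorem L_triangle {x : Comb (RatFunc F)} (hx : x [] = 0) (i : ℕ) (y : Comb (RatFunc F)) :
    L F i (triangle _ x y) = L F i x * Llt F i y := by
  have h : x ∈ Finsupp.supported (RatFunc F) (RatFunc F) {n : Arr | n ≠ []} := by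
    rintro n hn rfl
    exact Finsupp.mem_support_iff.1 hn hx
  have := map_mem_of_mem_supported ((triangle (RatFunc F)).compr₂ (L F i) -
      (LinearMap.mul (RatFunc F) (RatFunc F)).compl₁₂ (L F i) (Llt F i)) (N := ⊥) ?_ h
  · simpa [sub_eq_zero] using LinearMap.congr_fun ((Submodule.mem_bot _).1 this) y
  · rintro (_ | ⟨a, m⟩) hm
    · exact absurd rfl hm
    · rw [Submodule.mem_bot]
      refine linearMap_ext_arr fun n => ?_
      simp [triangle_arr_arr, triangleArr, L_prepend, Llt_stuffleArr, LArr, mul_assoc]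

end Carlitz

end CarlitzPolylog

/-! ### Frobenius, closed forms and the telescoping recursion -/

namespace CarlitzPolylog

theorem θ_pow_ne (F : Type*) [Field F] {a b : ℕ} (h : a ≠ b) : θ F ^ a ≠ θ F ^ b := by
  classical
  intro h'
  have := congrArg (RatFunc.inftyValuation F) h'
  simp only [θ, map_pow, RatFunc.inftyValuation.X] at this
  rw [← WithZero.exp_nsmul, ← WithZero.exp_nsmul, WithZero.exp_inj] at this
  simp at this
  exact h this

variable (F : Type*) [Field F] [Fintype F]

theorem sub_pow_card (x y : RatFunc F) :
    (x - y) ^ Fintype.card F = x ^ Fintype.card F - y ^ Fintype.card F := by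
  simpa using map_sub (FiniteField.frobeniusAlgHom F (RatFunc F)) x y

theorem sub_pow_card_pow (x y : RatFunc F) (m : ℕ) :
    (x - y) ^ Fintype.card F ^ m = x ^ Fintype.card F ^ m - y ^ Fintype.card F ^ m := by
  induction m with
  | zero => simp
  | succ m ih => simp only [pow_succ, pow_mul, ih, sub_pow_card]

theorem sum_pow_card {ι : Type*} (s : Finset ι) (f : ι → RatFunc F) :
    (∑ i ∈ s, f i) ^ Fintype.card F = ∑ i ∈ s, f i ^ Fintype.card F := by
  exact map_sum (FiniteField.frobeniusAlgHom F (RatFunc F)) f s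

theorem sum_pow_card_pow {ι : Type*} (s : Finset ι) (f : ι → RatFunc F) (m : ℕ) :
    (∑ i ∈ s, f i) ^ Fintype.card F ^ m = ∑ i ∈ s, f i ^ Fintype.card F ^ m := by
  induction m with
  | zero => simp
  | succ m ih => simp only [pow_succ, pow_mul, ih, sum_pow_card]

theorem neg_one_pow_pow_card (m : ℕ) :
    (((-1 : RatFunc F) ^ m) ^ Fintype.card F) = (-1) ^ m := by
  have : (-1 : RatFunc F) ^ Fintype.card F = -1 := by
    simpa using map_neg (FiniteField.frobeniusAlgHom F (RatFunc F)) 1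
  rw [← pow_mul, mul_comm, pow_mul, this]

theorem θ_sub_ne_zero (i : ℕ) : θ F - θ F ^ Fintype.card F ^ (i + 1) ≠ 0 := by
  have h := θ_pow_ne F (Nat.one_lt_pow i.succ_ne_zero (Fintype.one_lt_card (α := F))).ne
  rw [pow_one] at h
  exact sub_ne_zero.2 h

theorem l_ne_zero (i : ℕ) : l F i ≠ 0 := by
  induction i with
  | zero => simp [l]
  | succ i ih => exact mul_ne_zero (θ_sub_ne_zero F i) ih

theorem l_pow_card_eq (k : ℕ) : l F k ^ (Fintype.card F - 1) = l F k ^ Fintype.card F / l F k := by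
  rw [eq_div_iff (l_ne_zero F k), ← pow_succ, Nat.sub_add_cancel Fintype.card_pos]

/-- The value of `L_{<k}(q - 1)` in closed form. -/
theorem LltArr_qSubOne_succ (k : ℕ) :
    (θ F - θ F ^ Fintype.card F) * LltArr F [qSubOne F] (k + 1)
      = l F (k + 1) / l F k ^ Fintype.card F := by
  induction k with
  | zero => simp [LltArr, l]
  | succ k ih =>
    rw [LltArr_cons_succ, mul_add, ih, LArr, LltArr, mul_one]
    have h : (qSubOne F : ℕ) = Fintype.card F - 1 := rfl
    have h1 := l_ne_zero F k
    have h2 := θ_sub_ne_zero F k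
    rw [h, l_pow_card_eq, l.eq_2 _ (k + 1), l.eq_2 _ k, mul_pow, sub_pow_card, ← pow_mul,
      ← pow_succ]
    -- This is the `q`-th power of the factor in `h2`; it occurs in `l_{k+1}^q`.
    have h3 : θ F ^ Fintype.card F - θ F ^ Fintype.card F ^ (k + 1 + 1) ≠ 0 := by
      have := pow_ne_zero (Fintype.card F) h2
      rwa [sub_pow_card, ← pow_mul, ← pow_succ] at this
    field_simp
    ring

/-- The auxiliary value `(θ - θ ^ q) L_{<k}(q - 1) + (z - θ ^ q) / l_k ^ (q - 1)`. -/
theorem LltArr_qSubOne_add (k : ℕ) (z : RatFunc F) :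
    (θ F - θ F ^ Fintype.card F) * LltArr F [qSubOne F] k
        + (z - θ F ^ Fintype.card F) * (l F k ^ (Fintype.card F - 1))⁻¹
      = l F k * (z - θ F ^ Fintype.card F ^ (k + 1)) / l F k ^ Fintype.card F := by
  rw [l_pow_card_eq]
  cases k with
  | zero => simp [LltArr, l]
  | succ k =>
    rw [LltArr_qSubOne_succ, l.eq_2 _ k, mul_pow, sub_pow_card, ← pow_mul, ← pow_succ]
    have h1 := l_ne_zero F k
    have h2 := θ_sub_ne_zero F k
    have h3 : θ F ^ Fintype.card F - θ F ^ Fintype.card F ^ (k + 1 + 1) ≠ 0 := by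
      have := pow_ne_zero (Fintype.card F) h2
      rwa [sub_pow_card, ← pow_mul, ← pow_succ] at this
    field_simp
    ring

/-- In the difference of the two binomial expansions the terms with `h = d` cancel, which is why `h`
stays below `d`. -/
theorem sum_choose_sub_pow {R : Type*} [CommRing R] (d : ℕ) (a u v w : R) :
    ∑ h ∈ range d, (d.choose h : R) * (a ^ h * (w ^ (d - h) * (u ^ (d - h) - v ^ (d - h))))
      = (a + u * w) ^ d - (a + v * w) ^ d := by
  rw [add_pow, add_pow, ← sum_sub_distrib, sum_range_succ]
  simp only [Nat.sub_self, pow_zero, sub_self, add_zero]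
  refine sum_congr rfl fun h _ => ?_
  rw [mul_pow, mul_pow]
  ring

theorem L_c (d : ℕ+) (h : Fin d) (k : ℕ) :
    L F k (c F d h) = ((l F k ^ (Fintype.card F - 1))⁻¹) ^ ((d : ℕ) - h)
      * LltArr F [qSubOne F] k ^ (h : ℕ) := by
  rw [c, L_prepend, Llt_stufflePow, Llt_arr, inv_pow, ← pow_mul, mul_comm (_ - 1)]
  rfl

/-- The combination of the `𝔠_h` that occurs at each step of the recursion. -/
theorem sum_α_mul_L_c (d : ℕ+) (j k : ℕ) :
    (θ F - θ F ^ Fintype.card F ^ j) * ∑ h : Fin d, α F d h j * L F k (c F d h)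
      = (l F (k + 1) / l F k ^ Fintype.card F) ^ (d : ℕ)
        - (l F k * (θ F ^ Fintype.card F ^ j - θ F ^ Fintype.card F ^ (k + 1))
            / l F k ^ Fintype.card F) ^ (d : ℕ) := by
  have hq : (qSubOne F : ℕ) = Fintype.card F - 1 := rfl
  -- Both `d`-th powers are expanded around `a = (θ - θ^q) L_{<k}(q-1)`, with `w = l_k^{-(q-1)}`, `u
  -- = θ - θ^q` and `v = θ^{q^j} - θ^q`.
  rw [← LltArr_qSubOne_succ, ← LltArr_qSubOne_add, LltArr_cons_succ, LArr, LltArr, mul_one, hq,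
    mul_add, ← sum_choose_sub_pow, mul_sum, ← Fin.sum_univ_eq_sum_range (fun h =>
      ((d : ℕ).choose h : RatFunc F) * (((θ F - θ F ^ Fintype.card F) *
        LltArr F [qSubOne F] k) ^ h * ((l F k ^ (Fintype.card F - 1))⁻¹ ^ ((d : ℕ) - h) *
          ((θ F - θ F ^ Fintype.card F) ^ ((d : ℕ) - h)
            - (θ F ^ Fintype.card F ^ j - θ F ^ Fintype.card F) ^ ((d : ℕ) - h)))))]
  refine sum_congr rfl fun h _ => ?_
  have hf := fPoly_mul_sub ((d : ℕ) - h) (θ F) (θ F ^ Fintype.card F) (θ F ^ Fintype.card F ^ j)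
  rw [L_c, α, mul_pow]
  linear_combination (-((d : ℕ).choose h : RatFunc F) * (θ F - θ F ^ Fintype.card F) ^ (h : ℕ)
    * ((l F k ^ (Fintype.card F - 1))⁻¹) ^ ((d : ℕ) - h)
      * LltArr F [qSubOne F] k ^ (h : ℕ)) * hf

/-! ### Chains of triangle products -/

theorem c_mem_scaled (d : ℕ+) (h : Fin d) :
    c F d h ∈ Finsupp.supported (RatFunc F) (RatFunc F) (scaledArrays (qSubOne F) d) := by
  refine prepend_mem_scaled (w := h * 1) _ ?_
    (stufflePow_mem_scaled (arr_mem_supported ⟨[1], by simp, by simp [weight]⟩) _)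
  rw [PNat.mk_coe, mul_one, Nat.sub_add_cancel h.isLt.le]

/-- The chain `𝔠_{h₁}^{*q^s} ▷ (⋯ ▷ 𝔠_{hₘ}^{*q^{s+m-1}})`. -/
noncomputable def cChain (d : ℕ+) (m : ℕ) (h : Fin m → Fin d) (s : ℕ) : Comb (RatFunc F) :=
  triangleChain (RatFunc F)
    (List.ofFn fun j : Fin m =>
      stufflePow (RatFunc F) (c F d (h j)) (Fintype.card F ^ ((j : ℕ) + s)))

theorem cChain_zero (d : ℕ+) (h : Fin 0 → Fin d) (s : ℕ) : cChain F d 0 h s = arr _ [] := by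
  simp [cChain, triangleChain]

theorem cChain_succ (d : ℕ+) (m : ℕ) (h : Fin (m + 1) → Fin d) (s : ℕ) :
    cChain F d (m + 1) h s = triangle _ (stufflePow _ (c F d (h 0)) (Fintype.card F ^ s))
      (cChain F d m (Fin.tail h) (s + 1)) := by
  simp only [cChain, triangleChain, List.ofFn_succ, List.foldr_cons, Fin.val_zero, zero_add,
    Fin.val_succ, Fin.tail, add_assoc, add_comm 1]

theorem kElt_eq (d : ℕ+) (m : ℕ) (h : Fin m → Fin d) :
    kElt F d m h = prepend _ d (cChain F d m h 0) := by
  rw [kElt, triangleChain, List.foldr_cons, triangle_arr_singleton]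
  rfl

theorem cChain_mem_scaled (d : ℕ+) (m : ℕ) (h : Fin m → Fin d) (s : ℕ) :
    cChain F d m h s ∈ Finsupp.supported (RatFunc F) (RatFunc F)
      (scaledArrays (qSubOne F) ((d : ℕ) * ∑ i ∈ range m, Fintype.card F ^ (i + s))) := by
  induction m generalizing s with
  | zero =>
    rw [cChain_zero]
    exact arr_mem_supported ⟨[], rfl, by simp [weight]⟩
  | succ m ih =>
    rw [cChain_succ, sum_range_succ', mul_add, add_comm, zero_add, mul_comm (d : ℕ) (_ ^ s)]
    simp only [add_assoc, add_comm 1 s]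
    exact triangle_mem_scaled (stufflePow_mem_scaled (c_mem_scaled F d _) _) (ih _ _)

theorem stufflePow_c_apply_nil (d : ℕ+) (h : Fin d) (s : ℕ) :
    stufflePow _ (c F d h) (Fintype.card F ^ s) [] = 0 :=
  apply_nil_of_mem_scaled (Nat.mul_pos (pow_pos Fintype.card_pos s) d.pos)
    (stufflePow_mem_scaled (c_mem_scaled F d h) _)

/-- `L_k` is not multiplicative for the stuffle product, but it is the difference `L_{<k+1} -
L_{<k}` of two multiplicative maps, and raising to the power `q^s` respects differences. -/
theorem L_stufflePow_c (d : ℕ+) (h : Fin d) (s k : ℕ) :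
    L F k (stufflePow _ (c F d h) (Fintype.card F ^ s))
      = L F k (c F d h) ^ Fintype.card F ^ s := by
  have h1 := Llt_succ F (stufflePow_c_apply_nil F d h s) k
  have h2 := Llt_succ F (apply_nil_of_mem_scaled d.pos (c_mem_scaled F d h)) k
  rw [Llt_stufflePow, Llt_stufflePow] at h1
  rw [← sub_eq_iff_eq_add'] at h1 h2
  rw [← h1, ← h2, sub_pow_card_pow]

theorem Llt_cChain_succ (d : ℕ+) (m : ℕ) (h : Fin (m + 1) → Fin d) (s k : ℕ) :
    Llt F k (cChain F d (m + 1) h s) = ∑ j ∈ range k,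
      L F j (c F d (h 0)) ^ Fintype.card F ^ s * Llt F j (cChain F d m (Fin.tail h) (s + 1)) := by
  rw [Llt_eq_sum_L F, cChain_succ]
  · refine sum_congr rfl fun j _ => ?_
    rw [L_triangle F (stufflePow_c_apply_nil F d _ s), L_stufflePow_c]
  · refine apply_nil_of_mem_scaled (Nat.mul_pos d.pos ?_) (cChain_mem_scaled F d _ h s)
    exact sum_pos (fun i _ => pow_pos Fintype.card_pos _) ⟨0, by simp⟩

theorem Llt_cChain_shift (d : ℕ+) (m : ℕ) (h : Fin m → Fin d) (s k : ℕ) :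
    Llt F k (cChain F d m h (s + 1)) = Llt F k (cChain F d m h s) ^ Fintype.card F := by
  induction m generalizing s k with
  | zero => simp [cChain_zero, LltArr]
  | succ m ih =>
    rw [Llt_cChain_succ, Llt_cChain_succ, sum_pow_card]
    refine sum_congr rfl fun j _ => ?_
    rw [ih, mul_pow, pow_succ, pow_mul]

theorem coef_cons (d : ℕ+) (m : ℕ) (h₀ : Fin d) (h : Fin m → Fin d) :
    coef F d (m + 1) (Fin.cons h₀ h) = α F d h₀ (m + 1) * coef F d m h ^ Fintype.card F := by
  rw [coef, Fin.prod_univ_succ, coef, ← prod_pow]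
  simp [pow_succ, pow_mul]

/-- The sum `∑_h α_h L_{<k}(𝔠_{h₁} ▷ 𝔠_{h₂}^{*q} ▷ ⋯)`. -/
noncomputable def chainSum (d : ℕ+) (m k : ℕ) : RatFunc F :=
  ∑ h : Fin m → Fin d, coef F d m h * Llt F k (cChain F d m h 0)

theorem chainSum_zero (d : ℕ+) (k : ℕ) : chainSum F d 0 k = 1 := by
  simp [chainSum, cChain_zero, coef, LltArr]

/-- Splitting off `h₁` leaves a tail whose coefficients and stuffle exponents are those of a chain
of length `m`, twisted once by Frobenius. -/
theorem chainSum_succ (d : ℕ+) (m k : ℕ) :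
    chainSum F d (m + 1) k = ∑ j ∈ range k,
      (∑ h : Fin d, α F d h (m + 1) * L F j (c F d h)) * chainSum F d m j ^ Fintype.card F := by
  rw [chainSum, ← (Fin.consEquiv fun _ => Fin d).sum_comp, Fintype.sum_prod_type]
  simp only [Fin.consEquiv, Equiv.coe_fn_mk, coef_cons, Llt_cChain_succ, Fin.cons_zero,
    Fin.tail_cons, Llt_cChain_shift, pow_zero, pow_one, chainSum, sum_pow_card, mul_pow]
  simp only [mul_sum (range k)]
  refine (sum_congr rfl fun h _ => sum_comm).trans (sum_comm.trans (sum_congr rfl fun j _ => ?_))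
  rw [sum_mul_sum]
  refine sum_congr rfl fun h _ => sum_congr rfl fun h' _ => ?_
  ring

theorem chainSum_step (d : ℕ+) (m k : ℕ) :
    (-1) ^ (m + 1) * D F (m + 1) * chainSum F d (m + 1) (k + 1)
      = (-1) ^ (m + 1) * D F (m + 1) * chainSum F d (m + 1) k
        + ((l F (k + 1) / l F k ^ Fintype.card F) ^ (d : ℕ)
        - (l F k * (θ F ^ Fintype.card F ^ (m + 1) - θ F ^ Fintype.card F ^ (k + 1))
            / l F k ^ Fintype.card F) ^ (d : ℕ))
          * ((-1) ^ m * D F m * chainSum F d m k) ^ Fintype.card F := by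
  rw [chainSum_succ, sum_range_succ, ← chainSum_succ, ← sum_α_mul_L_c, mul_pow, mul_pow,
    neg_one_pow_pow_card, D]
  ring

/-- Induction on `m`, and for fixed `m` on `k`. The vanishing for `k < m` is part of the induction:
it supplies the initial value of the telescoping sum. -/
theorem chainSum_eq (d : ℕ+) (m k : ℕ) :
    (-1) ^ m * D F m * chainSum F d m k
      = if m ≤ k then l F k ^ (d : ℕ) * (l F (k - m) ^ ((d : ℕ) * Fintype.card F ^ m))⁻¹
        else 0 := by
  induction m generalizing k with
  | zero => simp [chainSum_zero, D, l_ne_zero]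
  | succ m ihm =>
    induction k with
    | zero => simp [chainSum_succ]
    | succ k ihk =>
      rw [chainSum_step, ihk, ihm]
      have hk := l_ne_zero F k
      rcases lt_trichotomy k m with hlt | rfl | hlt
      · rw [if_neg (by omega), if_neg (by omega), if_neg (by omega)]
        simp [Fintype.card_ne_zero]
      -- First non-zero value: for `k = m` the subtracted `d`-th power contains `θ^{q^{m+1}} -
      -- θ^{q^{k+1}} = 0`.
      · rw [if_neg (by omega), if_pos le_rfl, if_pos le_rfl]
        simp only [Nat.sub_self, l, one_pow, sub_self, mul_zero, zero_div, inv_one, mul_one,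
          zero_add, div_pow, ← pow_mul, zero_pow d.ne_zero, sub_zero]
        rw [mul_comm (Fintype.card F) (d : ℕ), div_mul_cancel₀ _ (pow_ne_zero _ hk)]
      · obtain ⟨t, rfl⟩ := Nat.exists_eq_add_of_lt hlt
        rw [if_pos (by omega), if_pos (by omega), if_pos (by omega)]
        have e1 : m + t + 1 - (m + 1) = t := by omega
        have e2 : m + t + 1 - m = t + 1 := by omega
        have e3 : m + t + 1 + 1 - (m + 1) = t + 1 := by omega
        -- This power of the last factor of `l_{t+1}` reduces `l_{t+1}` to `l_t` in the denominator,
        -- so the subtracted term cancels the value at `k`.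
        have e4 : θ F ^ Fintype.card F ^ (m + 1) - θ F ^ Fintype.card F ^ (m + t + 1 + 1)
            = (θ F - θ F ^ Fintype.card F ^ (t + 1)) ^ Fintype.card F ^ (m + 1) := by
          rw [sub_pow_card_pow, ← pow_mul, ← pow_add]
          congr 3
          ring
        have ht := l_ne_zero F t
        have hx := θ_sub_ne_zero F t
        rw [e1, e2, e3, e4, l.eq_2 F t]
        generalize θ F - θ F ^ Fintype.card F ^ (t + 1) = x at hx
        generalize l F t = y at ht
        generalize l F (m + t + 1 + 1) = z
        generalize l F (m + t + 1) = u at hk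
        simp only [mul_pow, div_pow, mul_inv, inv_pow, ← pow_mul]
        have e5 : (d : ℕ) * Fintype.card F ^ m * Fintype.card F
          = d * Fintype.card F ^ (m + 1) := by ring
        rw [e5, mul_comm (Fintype.card F) (d : ℕ), mul_comm (Fintype.card F ^ (m + 1)) (d : ℕ)]
        field_simp
        ring

theorem sum_coef_mul_L_kElt (d : ℕ+) (m k : ℕ) :
    (-1) ^ m * D F m * ∑ h : Fin m → Fin d, coef F d m h * L F k (kElt F d m h)
      = if m ≤ k then (l F (k - m) ^ ((d : ℕ) * Fintype.card F ^ m))⁻¹ else 0 := by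
  have h := chainSum_eq F d m k
  have hk := pow_ne_zero (d : ℕ) (l_ne_zero F k)
  have : ∑ h : Fin m → Fin d, coef F d m h * L F k (kElt F d m h)
      = (l F k ^ (d : ℕ))⁻¹ * chainSum F d m k := by
    rw [chainSum, mul_sum]
    refine sum_congr rfl fun h _ => ?_
    rw [kElt_eq, L_prepend, mul_left_comm]
  rw [this, mul_left_comm, h]
  split_ifs
  · rw [inv_mul_cancel_left₀ hk]
  · rw [mul_zero]

theorem mem_support_kElt (d : ℕ+) {m : ℕ} (hm : 1 ≤ m) (h : Fin m → Fin d) {n : Arr}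
    (hn : n ∈ (kElt F d m h).support) :
    weight n = (d : ℕ) * Fintype.card F ^ m ∧ 2 ≤ n.length ∧
      ∃ x : Arr, n = d :: x.map (fun a => a * qSubOne F) ∧
        weight x = (d : ℕ) * ∑ i ∈ range m, Fintype.card F ^ i := by
  rw [kElt_eq] at hn
  obtain ⟨n', hn', rfl⟩ := exists_of_mem_support_prepend hn
  obtain ⟨x, rfl, hx⟩ := cChain_mem_scaled F d m h 0 hn'
  simp only [add_zero] at hx
  refine ⟨?_, ?_, x, rfl, hx⟩
  · have hq : (qSubOne F : ℕ) = Fintype.card F - 1 := rfl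
    have hc : 1 ≤ Fintype.card F := Fintype.card_pos
    -- The geometric sum gives `d + (q - 1) d ∑ q^i = d q^m`.
    have h2 := geom_sum_mul_add (Fintype.card F - 1) m
    rw [Nat.sub_add_cancel hc] at h2
    rw [weight_cons, weight_map_mul, hx, hq, ← h2]
    ring
  · have hpos : 0 < weight x := by
      rw [hx]
      exact Nat.mul_pos d.pos (sum_pos (fun i _ => pow_pos Fintype.card_pos _)
        ⟨0, mem_range.2 hm⟩)
    cases x with
    | nil => simp [weight] at hpos
    | cons a x => simp

end CarlitzPolylog

/-! ### Convergence at the infinite place and passage to the limit -/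

namespace CarlitzPolylog

/-- The additive group of a valued ring is nonarchimedean. -/
theorem nonarchimedeanAddGroup_of_valued (R : Type*) [Ring R] {Γ₀ : Type*}
    [LinearOrderedCommGroupWithZero Γ₀] [Valued R Γ₀] : NonarchimedeanAddGroup R where
  is_nonarchimedean U hU := by
    obtain ⟨γ, hγ⟩ := Valued.mem_nhds_zero.1 hU
    exact ⟨⟨Valuation.ltAddSubgroup _ γ, Valued.isOpen_ball _ γ.1⟩, hγ⟩

section Completion

variable (F : Type*) [Field F] [DecidableEq (RatFunc F)]

instance : CompleteSpace (RatFunc.CompletionAtInfty F) :=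
  @UniformSpace.Completion.completeSpace (RatFunc F) (RatFunc.inftyValued F).toUniformSpace

theorem v_algebraMap (x : RatFunc F) :
    Valued.v (algebraMap (RatFunc F) (RatFunc.CompletionAtInfty F) x)
      = RatFunc.inftyValuation F x :=
  @Valued.valuedCompletion_apply (RatFunc F) _ _ _ (RatFunc.inftyValued F) x

theorem tendsto_algebraMap_of_inftyValuation_le {f : ℕ → RatFunc F}
    (h : ∀ i : ℕ, RatFunc.inftyValuation F (f i) ≤ WithZero.exp (-(i : ℤ))) :
    Tendsto (fun i => algebraMap (RatFunc F) (RatFunc.CompletionAtInfty F) (f i)) atTop (𝓝 0) := by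
  intro s hs
  obtain ⟨γ, hγ⟩ := Valued.mem_nhds_zero.1 hs
  have h0 : MonoidWithZeroHom.ValueGroup₀.embedding γ.1 ≠ 0 := by simp
  obtain ⟨N, hN⟩ := WithZero.ne_zero_iff_exists.1 h0
  rw [Filter.mem_map]
  -- The radius is `exp N` for an integer `N`, and `exp (-i) < exp N` once `i > -N`.
  filter_upwards [eventually_gt_atTop (-(Multiplicative.toAdd N)).toNat] with i hi
  refine Set.mem_preimage.2 (hγ ?_)
  rw [Set.mem_ofPred_eq, Valuation.restrict_lt_iff_lt_embedding, v_algebraMap]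
  refine (h i).trans_lt ?_
  rw [← hN]
  refine (WithZero.exp_lt_exp (b := Multiplicative.toAdd N)).2 ?_
  omega

end Completion

variable (F : Type*) [Field F] [Fintype F] [DecidableEq (RatFunc F)]

theorem inftyValuation_θ_sub (i : ℕ) :
    RatFunc.inftyValuation F (θ F - θ F ^ Fintype.card F ^ (i + 1))
      = WithZero.exp ((Fintype.card F ^ (i + 1) : ℕ) : ℤ) := by
  have h1 : RatFunc.inftyValuation F (θ F) = WithZero.exp 1 := RatFunc.inftyValuation.X F
  have h2 : RatFunc.inftyValuation F (θ F ^ Fintype.card F ^ (i + 1))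
      = WithZero.exp ((Fintype.card F ^ (i + 1) : ℕ) : ℤ) := by
    rw [map_pow, h1, ← WithZero.exp_nsmul]
    simp
  rw [Valuation.map_sub_eq_of_lt_right, h2]
  rw [h1, h2, WithZero.exp_lt_exp]
  exact_mod_cast Nat.one_lt_pow i.succ_ne_zero Fintype.one_lt_card

theorem exp_le_inftyValuation_l (i : ℕ) :
    WithZero.exp (i : ℤ) ≤ RatFunc.inftyValuation F (l F i) := by
  induction i with
  | zero => simp [l]
  | succ i ih =>
    rw [l, map_mul, inftyValuation_θ_sub, Nat.cast_succ, add_comm, WithZero.exp_add]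
    refine mul_le_mul' (WithZero.exp_le_exp.2 ?_) ih
    exact_mod_cast Nat.one_le_pow _ _ Fintype.card_pos

theorem inftyValuation_inv_l_pow_le (i : ℕ) (a : ℕ+) :
    RatFunc.inftyValuation F (l F i ^ (a : ℕ))⁻¹ ≤ WithZero.exp (-(i : ℤ)) := by
  have h := exp_le_inftyValuation_l F i
  have h1 : 1 ≤ RatFunc.inftyValuation F (l F i) :=
    le_trans (by rw [← WithZero.exp_zero]; exact WithZero.exp_le_exp.2 (by simp)) h
  rw [map_inv₀, map_pow, WithZero.exp_neg]
  refine inv_anti₀ WithZero.exp_pos (h.trans ?_)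
  exact le_self_pow₀ h1 a.ne_zero

theorem inftyValuation_LltArr_le_one (n : Arr) (i : ℕ) :
    RatFunc.inftyValuation F (LltArr F n i) ≤ 1 := by
  induction n generalizing i with
  | nil => simp [LltArr]
  | cons a n ih =>
    refine Valuation.map_sum_le _ fun j _ => ?_
    rw [map_mul]
    refine mul_le_one' ((inftyValuation_inv_l_pow_le F j a).trans ?_) (ih j)
    rw [← WithZero.exp_zero]
    exact WithZero.exp_le_exp.2 (by simp)

/-- In a complete nonarchimedean group it suffices that consecutive differences tend to zero; here
they have valuation at most `exp (-i)`. -/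
theorem tendsto_LltArr (n : Arr) :
    Tendsto (fun i : ℕ => algebraMap (RatFunc F) (RatFunc.CompletionAtInfty F) (LltArr F n i))
      atTop (𝓝 (LiArr F n)) := by
  have := nonarchimedeanAddGroup_of_valued (RatFunc.CompletionAtInfty F)
  refine CauchySeq.tendsto_limUnder
    (NonarchimedeanAddGroup.cauchySeq_of_tendsto_sub_nhds_zero ?_)
  simp only [← map_sub]
  refine tendsto_algebraMap_of_inftyValuation_le F fun i => ?_
  cases n with
  | nil => simp [LltArr]
  | cons a n =>
    rw [LltArr_cons_succ, add_sub_cancel_left, LArr, map_mul]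
    exact (mul_le_mul' (inftyValuation_inv_l_pow_le F i a)
      (inftyValuation_LltArr_le_one F n i)).trans_eq (mul_one _)

theorem Li_arr (n : Arr) : Li F (arr _ n) = LiArr F n := by
  simp [Li, arr]

theorem tendsto_Llt (x : Comb (RatFunc F)) :
    Tendsto (fun i : ℕ => algebraMap (RatFunc F) (RatFunc.CompletionAtInfty F) (Llt F i x))
      atTop (𝓝 (Li F x)) := by
  have h (i : ℕ) : algebraMap (RatFunc F) (RatFunc.CompletionAtInfty F) (Llt F i x)
      = ∑ n ∈ x.support, algebraMap (RatFunc F) (RatFunc.CompletionAtInfty F) (x n) *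
        algebraMap (RatFunc F) (RatFunc.CompletionAtInfty F) (LltArr F n i) := by
    simp [Llt, Finsupp.linearCombination_apply, Finsupp.sum]
  simp only [h, Li, Finsupp.linearCombination_apply, Finsupp.sum, Algebra.smul_def]
  exact tendsto_finsetSum _ fun n _ => (tendsto_LltArr F n).const_mul _

theorem Li_singleton_pow (d : ℕ+) (m : ℕ) :
    Li F (arr _ [d]) ^ (Fintype.card F ^ m) = Li F (arr _ [d * qq F ^ m]) := by
  refine tendsto_nhds_unique ((tendsto_Llt F (arr _ [d])).pow _) ?_
  convert! tendsto_Llt F (arr _ [d * qq F ^ m]) using 2 with i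
  have hq : (qq F : ℕ) = Fintype.card F := rfl
  rw [← map_pow, Llt_arr, Llt_arr, LltArr, LltArr, sum_pow_card_pow]
  refine congrArg _ (sum_congr rfl fun j _ => ?_)
  rw [LltArr, mul_one, mul_one, inv_pow, ← pow_mul, PNat.mul_coe, PNat.pow_coe, hq]

/-- The finite identity is summed over all indices below `i + m`: the first `m` contribute zero, and
the others are the terms of `L_{<i}(d q^m)` shifted by `m`. -/
theorem Llt_kElt_sum (d : ℕ+) (m i : ℕ) :
    Llt F (i + m) (((-1) ^ m * D F m) • ∑ h : Fin m → Fin d, coef F d m h • kElt F d m h)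
      = Llt F i (arr _ [d * qq F ^ m]) := by
  have hq : (qq F : ℕ) = Fintype.card F := rfl
  have h0 (h : Fin m → Fin d) : kElt F d m h [] = 0 := by
    by_contra h'
    rw [kElt_eq] at h'
    obtain ⟨n, -, hn⟩ := exists_of_mem_support_prepend (Finsupp.mem_support_iff.2 h')
    simp at hn
  simp only [map_smul, map_sum, smul_eq_mul, Llt_eq_sum_L F (h0 _)]
  simp only [mul_sum (range _)]
  rw [sum_comm, mul_sum]
  simp only [sum_coef_mul_L_kElt]
  rw [add_comm, sum_range_add, sum_eq_zero, zero_add, Llt_arr, LltArr]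
  · refine sum_congr rfl fun j _ => ?_
    rw [if_pos (Nat.le_add_right m j), Nat.add_sub_cancel_left, LltArr, mul_one, PNat.mul_coe,
      PNat.pow_coe, hq]
  · intro j hj
    rw [if_neg (by simpa using hj)]

theorem Li_singleton_eq (d : ℕ+) (m : ℕ) :
    Li F (arr _ [d * qq F ^ m])
      = Li F (((-1) ^ m * D F m) • ∑ h : Fin m → Fin d, coef F d m h • kElt F d m h) := by
  refine tendsto_nhds_unique (tendsto_Llt F _) ?_
  simp only [← Llt_kElt_sum]
  exact (tendsto_Llt F _).comp (tendsto_add_atTop_nat m)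

/-- Depth separates the two sides: no array of depth one occurs in any `𝔨_h`. -/
theorem arr_singleton_ne (d : ℕ+) {m : ℕ} (hm : 1 ≤ m) :
    arr (RatFunc F) [d * qq F ^ m]
      ≠ ((-1) ^ m * D F m) • ∑ h : Fin m → Fin d, coef F d m h • kElt F d m h := by
  intro h
  have h0 (h : Fin m → Fin d) : kElt F d m h [d * qq F ^ m] = 0 := by
    by_contra h'
    have := (mem_support_kElt F d hm h (Finsupp.mem_support_iff.2 h')).2.1
    simp at this
  have := DFunLike.congr_fun h [d * qq F ^ m]
  simp [arr, h0] at this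

end CarlitzPolylog

theorem theoremD (F : Type*) [Field F] [Fintype F] [DecidableEq (RatFunc F)]
    (d : ℕ+) (m : ℕ) (hm : 1 ≤ m) :
    -- the identity of finite sums
    (∀ k : ℕ, m ≤ k →
      CarlitzPolylog.L F (k - m)
          (CarlitzPolylog.arr (RatFunc F) [d * CarlitzPolylog.qq F ^ m])
        = (CarlitzPolylog.l F (k - m) ^ ((d : ℕ) * Fintype.card F ^ m))⁻¹ ∧
      (CarlitzPolylog.l F (k - m) ^ ((d : ℕ) * Fintype.card F ^ m))⁻¹
        = (-1) ^ m * CarlitzPolylog.D F m *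
          ∑ h : Fin m → Fin d,
            CarlitzPolylog.coef F d m h *
              CarlitzPolylog.L F k (CarlitzPolylog.kElt F d m h)) ∧
    -- the arrays that occur have weight `d q ^ m`, depth at least two, and a special form
    (∀ (h : Fin m → Fin d), ∀ n ∈ (CarlitzPolylog.kElt F d m h).support,
      CarlitzPolylog.weight n = (d : ℕ) * Fintype.card F ^ m ∧ 2 ≤ n.length ∧
      ∃ x : CarlitzPolylog.Arr,
        n = d :: x.map (fun a => a * CarlitzPolylog.qSubOne F) ∧
        CarlitzPolylog.weight x = (d : ℕ) * ∑ i ∈ Finset.range m, Fintype.card F ^ i) ∧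
    -- the series that define multiple polylogarithms at one converge
    (∀ n : CarlitzPolylog.Arr,
      Filter.Tendsto
        (fun i : ℕ => algebraMap (RatFunc F) (RatFunc.CompletionAtInfty F)
          (CarlitzPolylog.LltArr F n i))
        Filter.atTop (nhds (CarlitzPolylog.Li F (CarlitzPolylog.arr (RatFunc F) n)))) ∧
    -- the identity in the limit
    CarlitzPolylog.Li F (CarlitzPolylog.arr (RatFunc F) [d]) ^ (Fintype.card F ^ m)
      = CarlitzPolylog.Li F
          (CarlitzPolylog.arr (RatFunc F) [d * CarlitzPolylog.qq F ^ m]) ∧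
    CarlitzPolylog.Li F
        (CarlitzPolylog.arr (RatFunc F) [d * CarlitzPolylog.qq F ^ m])
      = algebraMap (RatFunc F) (RatFunc.CompletionAtInfty F)
          ((-1) ^ m * CarlitzPolylog.D F m) *
        ∑ h : Fin m → Fin d,
          algebraMap (RatFunc F) (RatFunc.CompletionAtInfty F)
              (CarlitzPolylog.coef F d m h) *
            CarlitzPolylog.Li F (CarlitzPolylog.kElt F d m h) ∧
    -- the linear relation is not trivial
    CarlitzPolylog.arr (RatFunc F) [d * CarlitzPolylog.qq F ^ m]
      ≠ ((-1) ^ m * CarlitzPolylog.D F m) •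
        ∑ h : Fin m → Fin d,
          CarlitzPolylog.coef F d m h • CarlitzPolylog.kElt F d m h := by
  refine ⟨fun k hk => ⟨?_, ?_⟩, fun h n hn => CarlitzPolylog.mem_support_kElt F d hm h hn,
    fun n => ?_, CarlitzPolylog.Li_singleton_pow F d m, ?_,
    CarlitzPolylog.arr_singleton_ne F d hm⟩
  · have hq : (CarlitzPolylog.qq F : ℕ) = Fintype.card F := rfl
    rw [CarlitzPolylog.L_arr, CarlitzPolylog.LArr, CarlitzPolylog.LltArr, mul_one, PNat.mul_coe,
      PNat.pow_coe, hq]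
  · rw [CarlitzPolylog.sum_coef_mul_L_kElt, if_pos hk]
  · rw [CarlitzPolylog.Li_arr]
    exact CarlitzPolylog.tendsto_LltArr F n
  · rw [CarlitzPolylog.Li_singleton_eq]
    simp only [map_smul, map_sum, Algebra.smul_def]
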